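/- Let $n,r\ge 0$ be integers and let $x^i_j$, $1\le i,j\le n$, be the coordinates on the space $Mat_n$ of $n\times n$ complex matrices. Let $\hat\sigma_r\subset Mat_n$ be the variety of matrices of rank at most $r$. For $M\in Mat_n$ let the $r$-rigidity of $M$ be the smallest $s$ such that $M=A+B$ with $A\in\hat\sigma_r$ and $B$ having exactly $s$ nonzero entries, and let $\hat{\mathcal R}[n,r,s]$ be the Zariski closure of the set of matrices of $r$-rigidity at most $s$. For a set $S\subset\{x^i_j\}$ let $L^S\subset Mat_n$ be the span of the coordinate directions in $S$ (the matrices supported on $S$), let $\hat J(\sigma_r,L^S)$ be the Zariski closure of $\{A+B : A\in\hat\sigma_r,\ B\in L^S\}$ (the affine cone over the join), and let $I(J(\sigma_r,L^S))\subset\mathbb C[x^i_j]$ be the ideal of all polynomials vanishing on it. For $I,J\subset\{1,\dots,n\}$ with $|I|=|J|=r+1$ let $M^I_J$ be the determinant of the submatrix of $(x^i_j)$ with rows $I$ and columns $J$. If $s\le n^2$, every irreducible component of $\hat{\mathcal R}[n,r,s]$ is of the form $\hat J(\sigma_r,L^S)$ for some $S$ with $|S|=s$. Moreover, for every $S\subset\{x^i_j\}$: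 1. The ideal $I(J(\sigma_r,L^S))$ is generated by the polynomials of the form $P=\sum_{I,J}q_I^J M^I_J$ in which no variable of $S$ appears, where the $q_I^J$ are homogeneous polynomials, all of the same degree. 2. In particular, $I(J(\sigma_r,L^S))$ contains no nonzero polynomial of degree at most $r$. 3. Conversely, for arbitrary polynomials $q_I^J$, if no variable of $S$ appears in $P=\sum_{I,J}q_I^J M^I_J$, then $P\in I(J(\sigma_r,L^S))$. -/

import Mathlib

noncomputable section

namespace MatrixRigidity

/-- The space of `n × n` complex matrices. -/
abbrev Mat (n : ℕ) : Type := Matrix (Fin n) (Fin n) ℂ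

/-- Polynomials on `Mat n`, in the coordinates `x^i_j`, indexed by `(i, j)` (row, column). -/
abbrev Poly (n : ℕ) : Type := MvPolynomial (Fin n × Fin n) ℂ

/-- The coordinates of a matrix. -/
def coords {n : ℕ} (M : Mat n) : Fin n × Fin n → ℂ := fun p => M p.1 p.2

/-- The ideal of all polynomials that vanish on the set `Z` of matrices. -/
def idealOf {n : ℕ} (Z : Set (Mat n)) : Ideal (Poly n) :=
  MvPolynomial.vanishingIdeal ℂ (coords '' Z)

/-- The Zariski closure: the common zero set of all polynomials that vanish on `Z`. -/
def zariskiClosure {n : ℕ} (Z : Set (Mat n)) : Set (Mat n) :=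
  coords ⁻¹' MvPolynomial.zeroLocus ℂ (idealOf Z)

/-- Zariski closed sets of matrices. -/
def IsZariskiClosed {n : ℕ} (Z : Set (Mat n)) : Prop := zariskiClosure Z = Z

/-- An irreducible Zariski closed set: non-empty, and not the union of two proper closed subsets. -/
def IsIrreducibleVariety {n : ℕ} (Z : Set (Mat n)) : Prop :=
  IsZariskiClosed Z ∧ Z.Nonempty ∧
    ∀ A B : Set (Mat n), IsZariskiClosed A → IsZariskiClosed B → Z = A ∪ B → Z = A ∨ Z = B

/-- `Z` is an irreducible component of `X`: a maximal irreducible closed set contained in `X`. -/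
def IsComponentOf {n : ℕ} (Z X : Set (Mat n)) : Prop :=
  Maximal (fun T : Set (Mat n) => IsIrreducibleVariety T ∧ T ⊆ X) Z

/-- The (affine cone over the) variety `σ_r` of `n × n` matrices of rank at most `r`. -/
def rankVariety (n r : ℕ) : Set (Mat n) := {M | M.rank ≤ r}

/-- The number of nonzero entries of a matrix. -/
def numNonzero {n : ℕ} (B : Mat n) : ℕ := {p : Fin n × Fin n | B p.1 p.2 ≠ 0}.ncard

/-- The `r`-rigidity of `M`: the smallest `s` such that `M = A + B` with `A` of rank at most `r`
and `B` having exactly `s` nonzero entries. -/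
def rigidity {n : ℕ} (r : ℕ) (M : Mat n) : ℕ :=
  sInf {s | ∃ A ∈ rankVariety n r, ∃ B : Mat n, numNonzero B = s ∧ M = A + B}

/-- The set of matrices of `r`-rigidity at most `s`. -/
def rigidSet (n r s : ℕ) : Set (Mat n) := {M | rigidity r M ≤ s}

/-- The variety of matrices of `r`-border rigidity at most `s`. -/
def rigidVariety (n r s : ℕ) : Set (Mat n) := zariskiClosure (rigidSet n r s)

/-- The linear space `L^S` of matrices spanned by the coordinate directions in `S`. -/
def coordSpace {n : ℕ} (S : Finset (Fin n × Fin n)) : Submodule ℂ (Mat n) :=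
  Submodule.span ℂ {B | ∃ p ∈ S, B = Matrix.single p.1 p.2 1}

/-- The affine cone over the join of the projective varieties whose affine cones are `X` and `Y`:
the points on lines joining a point of the one to a point of the other are the sums `x + y`. -/
def join {n : ℕ} (X Y : Set (Mat n)) : Set (Mat n) :=
  zariskiClosure {M | ∃ x ∈ X, ∃ y ∈ Y, M = x + y}

/-- The cone `J(σ_r, L^S)` over `σ_r` with vertex `L^S`, as an affine cone in `Mat n`. -/
def rankCone {n : ℕ} (r : ℕ) (S : Finset (Fin n × Fin n)) : Set (Mat n) :=
  join (rankVariety n r) (coordSpace S : Set (Mat n))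

/-- The subsets of `{1, …, n}` of size `k`. -/
abbrev IndexSet (n k : ℕ) : Type := {I : Finset (Fin n) // I.card = k}

/-- The minor `M^I_J`: the determinant of the submatrix with rows `I` and columns `J` of the
matrix of variables. -/
def minor {n k : ℕ} (I J : IndexSet n k) : Poly n :=
  ((Matrix.mvPolynomialX (Fin n) (Fin n) ℂ).submatrix
    (I.1.orderEmbOfFin I.2) (J.1.orderEmbOfFin J.2)).det

/-- The polynomial `∑ q^J_I M^I_J`, summed over all minors of size `k`. -/
def minorComb {n k : ℕ} (q : IndexSet n k → IndexSet n k → Poly n) : Poly n :=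
  ∑ I, ∑ J, q I J * minor I J

/-- Only variables outside `S` appear in `P`. -/
def AvoidsVars {n : ℕ} (S : Finset (Fin n × Fin n)) (P : Poly n) : Prop :=
  ∀ p ∈ P.vars, p ∉ S

end MatrixRigidity

end

/-! The core is that polynomials vanishing on matrices of rank at most r lie in the ideal of
(r+1)-minors (`idealOf_rankVariety`). It is proved with the Fischer inner product, for which linear
substitution by T is adjoint to substitution by its transpose. Subtracting an orthogonal projection
leaves a Q that still vanishes on rank at most r and is orthogonal to the minor ideal. If Q vanishes
in rank k, with k ≥ r, then N ↦ Q(YNZ) on (k+1)×(k+1) matrices vanishes where det N = 0, so det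
divides it. By adjointness and Cauchy–Binet it is orthogonal to itself, hence zero, and N = 1 gives
vanishing in rank k+1 (`mem_idealOf_rankVariety_succ`). Climbing to rank n gives Q = 0.

For the cone, expand P in the variables of S. The entries in S are free, so every coefficient
vanishes on the rank variety and hence lies in the minor ideal (`coeffIn_mem_idealOf`); its
homogeneous parts are the required generators.

For the components, the rigidity variety is a finite union of cones, each the closure of a
polynomial image of an affine space and so irreducible. -/

noncomputable section

namespace MatrixRigidity

open MvPolynomial Matrix

/-! ### The Fischer inner product on polynomials. -/

section Fischer

variable {σ τ : Type*}

/-- The product of the factorials of the exponents of a monomial. -/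
def multiFactorial (m : σ →₀ ℕ) : ℕ := m.prod fun _ e => e.factorial

lemma multiFactorial_pos (m : σ →₀ ℕ) : 0 < multiFactorial m :=
  Finset.prod_pos fun _ _ => Nat.factorial_pos _

lemma multiFactorial_add_single (m : σ →₀ ℕ) (i : σ) :
    multiFactorial (m + Finsupp.single i 1) = multiFactorial m * (m i + 1) := by
  classical
  unfold multiFactorial
  have key : ∀ f : σ →₀ ℕ, f.prod (fun _ e => e.factorial) =
      (f i).factorial * (f.erase i).prod (fun _ e => e.factorial) := fun f =>
    (Finsupp.mul_prod_erase' f i _ fun _ => rfl).symm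
  rw [key (m + Finsupp.single i 1), key m, Finsupp.erase_add, Finsupp.erase_single, add_zero]
  simp only [Finsupp.add_apply, Finsupp.single_eq_same, Nat.factorial_succ]
  ring

/-- The bilinear Fischer pairing, in which multiplication by a variable is adjoint to the partial
derivative. -/
def fischer : MvPolynomial σ ℂ →ₗ[ℂ] MvPolynomial σ ℂ →ₗ[ℂ] ℂ :=
  (basisMonomials σ ℂ).constr ℂ fun m => (multiFactorial m : ℂ) • lcoeff ℂ m

lemma fischer_monomial (m : σ →₀ ℕ) (a : ℂ) (Q : MvPolynomial σ ℂ) :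
    fischer (monomial m a) Q = a * (multiFactorial m * Q.coeff m) := by
  have h : monomial m a = a • basisMonomials σ ℂ m := by
    simp [smul_monomial]
  rw [h, map_smul, fischer, Module.Basis.constr_basis]
  simp

lemma fischer_eq_sum (P Q : MvPolynomial σ ℂ) :
    fischer P Q = ∑ m ∈ P.support, P.coeff m * (multiFactorial m * Q.coeff m) := by
  conv_lhs => rw [P.as_sum]
  simp only [map_sum, LinearMap.sum_apply, fischer_monomial]

lemma fischer_comm (P Q : MvPolynomial σ ℂ) : fischer P Q = fischer Q P := by
  classical
  induction P using MvPolynomial.induction_on' with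
  | add p q hp hq => simp [hp, hq]
  | monomial m a =>
    induction Q using MvPolynomial.induction_on' with
    | add p q hp hq => simp [hp, hq]
    | monomial m' b =>
      rw [fischer_monomial, fischer_monomial, coeff_monomial, coeff_monomial]
      by_cases h : m = m'
      · subst h; simp; ring
      · simp [h, Ne.symm h]

lemma fischer_X_mul (i : σ) (P Q : MvPolynomial σ ℂ) :
    fischer (X i * P) Q = fischer P (pderiv i Q) := by
  induction P using MvPolynomial.induction_on' with
  | add p q hp hq => simp [mul_add, hp, hq]
  | monomial m a =>
    rw [X, monomial_mul, add_comm, fischer_monomial, fischer_monomial, coeff_pderiv,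
      multiFactorial_add_single]
    push_cast
    ring

lemma fischer_one (Q : MvPolynomial σ ℂ) : fischer 1 Q = constantCoeff Q := by
  have := fischer_monomial 0 1 Q
  simpa [multiFactorial, constantCoeff_eq] using this

lemma fischer_C (a : ℂ) (Q : MvPolynomial σ ℂ) : fischer (C a) Q = a * constantCoeff Q := by
  rw [← fischer_one, ← smul_eq_mul, ← LinearMap.smul_apply, ← map_smul, smul_eq_C_mul, mul_one]

/-- The substitution `X s ↦ ∑ t, T s t * X t`. -/
def linSubst [Fintype τ] (T : σ → τ → ℂ) : MvPolynomial σ ℂ →ₐ[ℂ] MvPolynomial τ ℂ :=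
  aeval fun s => ∑ t, C (T s t) * X t

@[simp]
lemma linSubst_X [Fintype τ] (T : σ → τ → ℂ) (s : σ) :
    linSubst T (X s) = ∑ t, C (T s t) * X t := aeval_X _ _

lemma pderiv_linSubst [Fintype σ] [Fintype τ] (T : σ → τ → ℂ) (t : τ) (Q : MvPolynomial σ ℂ) :
    pderiv t (linSubst T Q) = ∑ s, C (T s t) * linSubst T (pderiv s Q) := by
  classical
  induction Q using MvPolynomial.induction_on with
  | C a => simp [linSubst]
  | add p q hp hq => simp [hp, hq, mul_add, Finset.sum_add_distrib]
  | mul_X p s hp =>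
    have h1 : pderiv t (∑ u, C (T s u) * X u : MvPolynomial τ ℂ) = C (T s t) := by
      rw [map_sum, Finset.sum_eq_single t]
      · simp
      · intro b _ hb; simp [pderiv_X_of_ne hb]
      · simp
    have h2 : ∀ u, pderiv u (p * X s) = pderiv u p * X s + (if u = s then p else 0) := by
      intro u
      rw [pderiv_mul]
      by_cases h : u = s
      · subst h; simp
      · simp [h, pderiv_X_of_ne (Ne.symm h)]
    rw [map_mul, pderiv_mul, hp, linSubst_X, h1]
    simp only [h2, map_add, map_mul, linSubst_X, mul_add, Finset.sum_add_distrib, Finset.sum_mul]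
    congr 1
    · simp [mul_assoc]
    · rw [Finset.sum_eq_single s]
      · simp [mul_comm]
      · intro b _ hb; simp [hb]
      · simp

lemma constantCoeff_linSubst [Fintype τ] (T : σ → τ → ℂ) (Q : MvPolynomial σ ℂ) :
    constantCoeff (linSubst T Q) = constantCoeff Q := by
  induction Q using MvPolynomial.induction_on with
  | C a => simp [linSubst]
  | add p q hp hq => simp [hp, hq]
  | mul_X p s hp => simp

/-- Removing a variable from P differentiates Q, and the chain rule `pderiv_linSubst` matches the
two sides. The induction must let Q vary because it is replaced by its derivatives. -/
lemma fischer_linSubst [Fintype σ] [Fintype τ] (T : σ → τ → ℂ) (P : MvPolynomial σ ℂ)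
    (Q : MvPolynomial τ ℂ) :
    fischer (linSubst T P) Q = fischer P (linSubst (fun t s => T s t) Q) := by
  induction P using MvPolynomial.induction_on generalizing Q with
  | C a =>
    have h2 : linSubst T (C a) = C a := by simp [linSubst]
    rw [h2, fischer_C, fischer_C, constantCoeff_linSubst]
  | add p q hp hq => simp [hp, hq]
  | mul_X p s hp =>
    rw [mul_comm, map_mul, fischer_X_mul, linSubst_X, pderiv_linSubst, Finset.sum_mul]
    simp only [map_sum, LinearMap.sum_apply, ← smul_eq_C_mul, map_smul, smul_mul_assoc,
      LinearMap.smul_apply, fischer_X_mul, hp]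

/-- Complex conjugation of the coefficients. -/
abbrev conjPoly (P : MvPolynomial σ ℂ) : MvPolynomial σ ℂ := MvPolynomial.map (starRingEnd ℂ) P

lemma conjPoly_conjPoly (P : MvPolynomial σ ℂ) : conjPoly (conjPoly P) = P := by
  ext m
  simp [conjPoly, coeff_map]

lemma conj_fischer (P Q : MvPolynomial σ ℂ) :
    starRingEnd ℂ (fischer P Q) = fischer (conjPoly P) (conjPoly Q) := by
  induction P using MvPolynomial.induction_on' with
  | add p q hp hq => simp [conjPoly, hp, hq]
  | monomial m a => simp [conjPoly, fischer_monomial, coeff_map]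

lemma support_conjPoly (P : MvPolynomial σ ℂ) : (conjPoly P).support = P.support :=
  support_map_of_injective P (RingHom.injective _)

lemma fischer_conjPoly_self (P : MvPolynomial σ ℂ) :
    fischer (conjPoly P) P =
      ((∑ m ∈ P.support, multiFactorial m * Complex.normSq (P.coeff m) : ℝ) : ℂ) := by
  rw [fischer_eq_sum, support_conjPoly]
  push_cast
  refine Finset.sum_congr rfl fun m _ => ?_
  rw [coeff_map, ← Complex.mul_conj]
  ring

lemma eq_zero_of_fischer_conjPoly_self {P : MvPolynomial σ ℂ}
    (h : fischer (conjPoly P) P = 0) : P = 0 := by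
  rw [fischer_conjPoly_self, Complex.ofReal_eq_zero, Finset.sum_eq_zero_iff_of_nonneg] at h
  · by_contra hP
    obtain ⟨m, hm⟩ := Finset.nonempty_of_ne_empty (support_eq_empty.not.mpr hP)
    have := h m hm
    simp [(multiFactorial_pos m).ne', mem_support_iff.mp hm] at this
  · intro m _
    exact mul_nonneg (Nat.cast_nonneg _) (Complex.normSq_nonneg _)

/-- The Fischer inner product. -/
@[reducible]
def fischerCore : InnerProductSpace.Core ℂ (MvPolynomial σ ℂ) where
  inner P Q := fischer (conjPoly P) Q
  conj_inner_symm P Q := by rw [conj_fischer, conjPoly_conjPoly, fischer_comm]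
  re_inner_nonneg P := by
    rw [fischer_conjPoly_self]
    exact Finset.sum_nonneg fun m _ => mul_nonneg (Nat.cast_nonneg _) (Complex.normSq_nonneg _)
  add_left P Q R := by simp [conjPoly]
  smul_left P Q a := by
    simp only [conjPoly, smul_eq_C_mul, map_mul, map_C]
    rw [← smul_eq_C_mul, map_smul, LinearMap.smul_apply, smul_eq_mul]
  definite _ := eq_zero_of_fischer_conjPoly_self

end Fischer

/-- Orthogonal projection; W is finite-dimensional because the polynomial ring is not complete. -/
lemma exists_sub_orthogonal {V : Type*} [AddCommGroup V] [Module ℂ V]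
    (c : InnerProductSpace.Core ℂ V) (W : Submodule ℂ V) [FiniteDimensional ℂ W] (v : V) :
    ∃ w ∈ W, ∀ u ∈ W, c.inner u (v - w) = 0 := by
  let : NormedAddCommGroup V := c.toNormedAddCommGroup
  let : InnerProductSpace ℂ V := InnerProductSpace.ofCore c.toCore
  obtain ⟨w, hw, z, hz, rfl⟩ := W.exists_add_mem_mem_orthogonal v
  refine ⟨w, hw, fun u hu => ?_⟩
  rw [add_sub_cancel_left]
  exact (Submodule.mem_orthogonal W z).mp hz u hu

/-! ### Irreducibility of the generic determinant. -/

lemma det_mem_subalgebra {R A : Type*} [CommRing R] [CommRing A] [Algebra R A]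
    (S : Subalgebra R A) {k : ℕ} {M : Matrix (Fin k) (Fin k) A} (h : ∀ i j, M i j ∈ S) :
    M.det ∈ S := by
  rw [det_apply]
  refine S.sum_mem fun p _ => ?_
  rw [Units.smul_def]
  exact S.zsmul_mem (S.prod_mem fun i _ => h _ _) _

/-- Laplace expansion makes the determinant linear in one variable, m * X + c, with m irreducible by
induction; it remains to see that m does not divide c. Arbitrary injections f, g keep the smaller
minors in the same polynomial ring. -/
lemma irreducible_det_submatrix {ι κ : Type*} {R : Type*} [CommRing R] [IsDomain R] (k : ℕ)
    (f : Fin (k + 1) → ι) (g : Fin (k + 1) → κ) (hf : f.Injective) (hg : g.Injective) :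
    Irreducible ((mvPolynomialX ι κ R).submatrix f g).det := by
  classical
  induction k with
  | zero =>
    have h := irreducible_mul_X_add (R := R) 1 0 (f 0, g 0) one_ne_zero (by simp) (by simp)
      isRelPrime_one_left
    rw [one_mul, add_zero] at h
    have h' : ((mvPolynomialX ι κ R).submatrix f g).det = X (f 0, g 0) := det_fin_one _
    rwa [h']
  | succ k ih =>
    set m := ((mvPolynomialX ι κ R).submatrix (f ∘ Fin.succ) (g ∘ Fin.succ)).det with hm
    have hirr : Irreducible m :=
      ih _ _ (hf.comp (Fin.succ_injective _)) (hg.comp (Fin.succ_injective _))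
    set c : MvPolynomial (ι × κ) R := ∑ j : Fin (k + 1), (-1) ^ (j.succ : ℕ) * X (f 0, g j.succ) *
      ((mvPolynomialX ι κ R).submatrix (f ∘ Fin.succ) (g ∘ j.succ.succAbove)).det with hc
    have hdet : ((mvPolynomialX ι κ R).submatrix f g).det = m * X (f 0, g 0) + c := by
      rw [det_succ_row_zero, Fin.sum_univ_succ]
      simp [hm, hc, mul_comm, submatrix_submatrix]
    have hX : ∀ (p : ι × κ), p ≠ (f 0, g 0) → (X p : MvPolynomial (ι × κ) R) ∈
        supported R ({(f 0, g 0)}ᶜ : Set (ι × κ)) := by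
      intro p hp
      rw [X_mem_supported]
      exact hp
    have hmin : ∀ g' : Fin (k + 1) → κ,
        ((mvPolynomialX ι κ R).submatrix (f ∘ Fin.succ) g').det ∈
        supported R ({(f 0, g 0)}ᶜ : Set (ι × κ)) := by
      intro g'
      refine det_mem_subalgebra _ fun i j => hX _ fun h => ?_
      exact Fin.succ_ne_zero i (hf (congrArg Prod.fst h))
    have hnot : ∀ p : MvPolynomial (ι × κ) R, p ∈ supported R ({(f 0, g 0)}ᶜ : Set (ι × κ)) →
        (f 0, g 0) ∉ p.vars := by
      intro p hp h
      exact (mem_supported.mp hp h) rfl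
    have hcs : c ∈ supported R ({(f 0, g 0)}ᶜ : Set (ι × κ)) := by
      refine Subalgebra.sum_mem _ fun j _ => Subalgebra.mul_mem _ (Subalgebra.mul_mem _ ?_ ?_)
        (hmin _)
      · exact Subalgebra.pow_mem _ (Subalgebra.neg_mem _ (Subalgebra.one_mem _)) _
      · refine hX _ fun h => ?_
        exact Fin.succ_ne_zero j (hg (congrArg Prod.snd h))
    rw [hdet]
    refine irreducible_mul_X_add m c _ hirr.ne_zero (hnot _ (hmin _)) (hnot _ hcs) ?_
    rw [hirr.isRelPrime_iff_not_dvd]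
    rintro ⟨q, hq⟩
    -- If m divided c, it would divide the determinant. At the permutation matrix of the swap (0 1),
    -- m has a zero row while the determinant is -1.
    let v : ι × κ → R := fun p => if ∃ i, p.1 = f i ∧ p.2 = g (Equiv.swap 0 1 i) then 1 else 0
    have hv : ∀ i j, v (f i, g j) = if Equiv.swap 0 1 i = j then 1 else 0 := by
      intro i j
      refine if_congr ⟨?_, ?_⟩ rfl rfl
      · rintro ⟨i', h1, h2⟩
        rw [hf h1, hg h2]
      · rintro rfl
        exact ⟨i, rfl, rfl⟩
    have hvm : eval v m = 0 := by
      rw [hm, RingHom.map_det]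
      refine det_eq_zero_of_row_eq_zero 0 fun j => ?_
      simp only [RingHom.mapMatrix_apply, Matrix.map_apply, submatrix_apply, mvPolynomialX_apply,
        eval_X, Function.comp_apply, hv]
      rw [if_neg]
      simp [Ne.symm (Fin.succ_ne_zero j)]
    have hvd : eval v ((mvPolynomialX ι κ R).submatrix f g).det =
        ((Equiv.Perm.sign (Equiv.swap (0 : Fin (k + 2)) 1) : ℤ) : R) := by
      rw [RingHom.map_det, ← det_permutation]
      congr 1
      ext i j
      simp [hv, PEquiv.toMatrix_apply, Equiv.toPEquiv_apply, eq_comm]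
    rw [hdet, hq, map_add, map_mul, map_mul, hvm, Equiv.Perm.sign_swap (by simp)] at hvd
    simp at hvd

lemma irreducible_det_mvPolynomialX (k : ℕ) :
    Irreducible (mvPolynomialX (Fin (k + 1)) (Fin (k + 1)) ℂ).det :=
  irreducible_det_submatrix k id id Function.injective_id Function.injective_id

lemma aeval_coords_det {k : ℕ} (M : Mat k) :
    aeval (coords M) (mvPolynomialX (Fin k) (Fin k) ℂ).det = M.det := by
  rw [AlgHom.map_det]
  congr 1
  ext i j
  simp [coords]

/-- A polynomial vanishing on all singular matrices is divisible by the determinant. -/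
lemma det_dvd_of_vanishing {k : ℕ} (Q : Poly (k + 1))
    (h : ∀ M : Mat (k + 1), M.det = 0 → aeval (coords M) Q = 0) :
    (mvPolynomialX (Fin (k + 1)) (Fin (k + 1)) ℂ).det ∣ Q := by
  set d := (mvPolynomialX (Fin (k + 1)) (Fin (k + 1)) ℂ).det with hd
  have hp : (Ideal.span {d}).IsPrime :=
    (Ideal.span_singleton_prime (irreducible_det_mvPolynomialX k).ne_zero).mpr
      (irreducible_det_mvPolynomialX k).prime
  -- Nullstellensatz for the prime ideal (det).
  rw [← Ideal.mem_span_singleton, ← IsPrime.vanishingIdeal_zeroLocus (K := ℂ) (Ideal.span {d})]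
  intro x hx
  have h1 := hx d (Ideal.mem_span_singleton_self d)
  have hx' : x = coords (Matrix.of fun i j => x (i, j)) := rfl
  rw [hx'] at h1 ⊢
  rw [aeval_coords_det] at h1
  exact h _ h1

/-! ### The minor ideal, Cauchy–Binet and the rank variety. -/

/-- The ideal generated by the minors of size `k`. -/
def minorIdeal (n k : ℕ) : Ideal (Poly n) :=
  Ideal.span (Set.range fun p : IndexSet n k × IndexSet n k => minor p.1 p.2)

lemma exists_orderEmb_comp_perm {n k : ℕ} (f : Fin k → Fin n) (hf : f.Injective) :
    ∃ (I : IndexSet n k) (e : Equiv.Perm (Fin k)), f = I.1.orderEmbOfFin I.2 ∘ e := by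
  classical
  have hI : (Finset.univ.image f).card = k := by
    rw [Finset.card_image_of_injective _ hf, Finset.card_fin]
  have hmem : ∀ i, ∃ j, (Finset.univ.image f).orderEmbOfFin hI j = f i := by
    intro i
    have : f i ∈ Set.range ((Finset.univ.image f).orderEmbOfFin hI) := by
      rw [Finset.range_orderEmbOfFin]; simp
    exact this
  choose e he using hmem
  have hinj : e.Injective := fun a b hab => hf (by rw [← he, ← he, hab])
  refine ⟨⟨_, hI⟩, Equiv.ofBijective e (Finite.injective_iff_bijective.mp hinj), ?_⟩
  funext i
  exact (he i).symm

/-- A repeated index gives zero; otherwise sorting the indices changes only the sign. -/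
lemma det_submatrix_mem_minorIdeal {n k : ℕ} (f g : Fin k → Fin n) :
    ((mvPolynomialX (Fin n) (Fin n) ℂ).submatrix f g).det ∈ minorIdeal n k := by
  by_cases hf : f.Injective
  · by_cases hg : g.Injective
    · obtain ⟨I, e, rfl⟩ := exists_orderEmb_comp_perm f hf
      obtain ⟨J, e', rfl⟩ := exists_orderEmb_comp_perm g hg
      have h1 : (mvPolynomialX (Fin n) (Fin n) ℂ).submatrix (I.1.orderEmbOfFin I.2 ∘ e)
          (J.1.orderEmbOfFin J.2 ∘ e') =
          (((mvPolynomialX (Fin n) (Fin n) ℂ).submatrix (I.1.orderEmbOfFin I.2)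
          (J.1.orderEmbOfFin J.2)).submatrix e id).submatrix id e' := rfl
      rw [h1, det_permute', det_permute]
      exact Ideal.mul_mem_left _ _ (Ideal.mul_mem_left _ _ (Ideal.subset_span ⟨(I, J), rfl⟩))
    · obtain ⟨a, b, hab, hne⟩ := Function.not_injective_iff.mp hg
      rw [det_zero_of_column_eq hne fun i => by simp [hab]]
      exact Ideal.zero_mem _
  · obtain ⟨a, b, hab, hne⟩ := Function.not_injective_iff.mp hf
    rw [det_zero_of_row_eq hne (by funext i; simp [hab])]
    exact Ideal.zero_mem _

/-- Multilinearity in the rows: Cauchy–Binet before terms with the same index set are grouped. -/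
lemma det_mul_eq_sum {R : Type*} [CommRing R] {n k : ℕ} (A : Matrix (Fin k) (Fin n) R)
    (M : Matrix (Fin n) (Fin k) R) :
    (A * M).det = ∑ p : Fin k → Fin n, (∏ i, A i (p i)) * (M.submatrix p id).det := by
  have h : A * M = fun i => ∑ j, A i j • M j := by
    ext i l
    simp [Matrix.mul_apply, Finset.sum_apply]
  have h2 := (detRowAlternating (n := Fin k) (R := R)).toMultilinearMap.map_sum
    (fun i j => A i j • M j)
  calc (A * M).det = detRowAlternating.toMultilinearMap (fun i => ∑ j, A i j • M j) := by
        rw [h]; rfl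
    _ = _ := by
        rw [h2]
        refine Finset.sum_congr rfl fun p _ => ?_
        rw [MultilinearMap.map_smul_univ]
        rfl

lemma det_mul_mul_mem_minorIdeal {n k : ℕ} (A : Matrix (Fin k) (Fin n) (Poly n))
    (B : Matrix (Fin n) (Fin k) (Poly n)) :
    (A * mvPolynomialX (Fin n) (Fin n) ℂ * B).det ∈ minorIdeal n k := by
  rw [Matrix.mul_assoc, det_mul_eq_sum]
  refine Ideal.sum_mem _ fun p _ => Ideal.mul_mem_left _ _ ?_
  have h : ((mvPolynomialX (Fin n) (Fin n) ℂ * B).submatrix p id) =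
      (mvPolynomialX (Fin n) (Fin n) ℂ).submatrix p id * B := by
    ext i j
    simp [Matrix.mul_apply]
  rw [h, ← det_transpose, transpose_mul, det_mul_eq_sum]
  refine Ideal.sum_mem _ fun q _ => Ideal.mul_mem_left _ _ ?_
  rw [← det_transpose]
  exact det_submatrix_mem_minorIdeal p q

lemma minorIdeal_succ_le (n k : ℕ) : minorIdeal n (k + 1) ≤ minorIdeal n k := by
  refine Ideal.span_le.mpr ?_
  rintro _ ⟨⟨I, J⟩, rfl⟩
  simp only [minor, SetLike.mem_coe]
  rw [det_succ_row_zero]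
  refine Ideal.sum_mem _ fun j _ => Ideal.mul_mem_left _ _ ?_
  rw [submatrix_submatrix]
  exact det_submatrix_mem_minorIdeal _ _

lemma mem_idealOf {n : ℕ} {Z : Set (Mat n)} {P : Poly n} :
    P ∈ idealOf Z ↔ ∀ M ∈ Z, aeval (coords M) P = 0 := by
  simp [idealOf]

lemma mem_rankVariety_iff {n r : ℕ} {M : Mat n} :
    M ∈ rankVariety n r ↔
      ∃ (Y : Matrix (Fin n) (Fin r) ℂ) (Z : Matrix (Fin r) (Fin n) ℂ), M = Y * Z := by
  constructor
  · intro hM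
    obtain ⟨V, U, e, hV, hU, h⟩ := exists_rank_normal_form M
    -- N factors the normal form as N * Nᵀ; its columns beyond the rank are zero, padding the width
    -- to r.
    let N : Matrix (Fin n) (Fin r) ℂ := of fun i j =>
      Sum.elim (fun a : Fin M.rank => if (a : ℕ) = j then 1 else 0) (fun _ => 0) (e i)
    have hN : (fromBlocks 1 0 0 0 : Matrix (Fin M.rank ⊕ Fin (Fintype.card (Fin n) - M.rank))
        _ ℂ).submatrix e e = N * Nᵀ := by
      ext i i'
      rw [submatrix_apply, Matrix.mul_apply]
      simp only [N, transpose_apply, of_apply]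
      rcases e i with a | a <;> rcases e i' with b | b <;> simp only [Sum.elim_inl, Sum.elim_inr,
        fromBlocks_apply₁₁, fromBlocks_apply₁₂, fromBlocks_apply₂₁, fromBlocks_apply₂₂,
        Matrix.zero_apply, mul_zero, zero_mul, Finset.sum_const_zero]
      have ha : (a : ℕ) < r := lt_of_lt_of_le a.2 hM
      rw [Finset.sum_eq_single ⟨a, ha⟩]
      · simp [Matrix.one_apply, Fin.ext_iff, eq_comm]
      · intro j _ hj
        rw [if_neg, zero_mul]
        exact fun h => hj (Fin.ext h.symm)
      · simp
    rw [hN] at h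
    refine ⟨V⁻¹ * N, Nᵀ * U⁻¹, ?_⟩
    have hV' := (isUnit_iff_isUnit_det _).mp hV
    have hU' := (isUnit_iff_isUnit_det _).mp hU
    calc M = V⁻¹ * (V * M * U) * U⁻¹ := by
          rw [Matrix.mul_assoc V, nonsing_inv_mul_cancel_left _ _ hV',
            mul_nonsing_inv_cancel_right _ _ hU']
      _ = _ := by rw [h]; simp only [Matrix.mul_assoc]
  · rintro ⟨Y, Z, rfl⟩
    exact (rank_mul_le_left Y Z).trans (rank_le_width Y)

lemma minor_isHomogeneous {n k : ℕ} (I J : IndexSet n k) : (minor I J).IsHomogeneous k := by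
  rw [minor, det_apply]
  refine IsHomogeneous.sum _ _ _ fun p _ => ?_
  rw [Units.smul_def, zsmul_eq_mul, ← map_intCast (C : ℂ →+* Poly n)]
  have h : (∏ i, (mvPolynomialX (Fin n) (Fin n) ℂ).submatrix (I.1.orderEmbOfFin I.2)
      (J.1.orderEmbOfFin J.2) (p i) i).IsHomogeneous (∑ _i : Fin k, 1) :=
    IsHomogeneous.prod _ _ _ fun i _ => isHomogeneous_X _ _
  have h2 := (isHomogeneous_C (Fin n × Fin n) (((Equiv.Perm.sign p : ℤˣ) : ℤ) : ℂ)).mul h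
  rwa [Finset.sum_const, Finset.card_fin, smul_eq_mul, mul_one, zero_add] at h2

lemma mem_minorIdeal_iff {n k : ℕ} {P : Poly n} :
    P ∈ minorIdeal n k ↔ ∃ q : IndexSet n k → IndexSet n k → Poly n, P = minorComb q := by
  rw [minorIdeal, Ideal.mem_span_range_iff_exists_fun]
  simp only [Fintype.sum_prod_type]
  constructor
  · rintro ⟨c, rfl⟩
    exact ⟨fun I J => c (I, J), rfl⟩
  · rintro ⟨q, rfl⟩
    exact ⟨fun p => q p.1 p.2, rfl⟩

lemma homogeneousComponent_mul_of_isHomogeneous {σ R : Type*} [CommSemiring R]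
    {M : MvPolynomial σ R} {k : ℕ} (hM : M.IsHomogeneous k) (q : MvPolynomial σ R) (d : ℕ) :
    homogeneousComponent d (q * M) = if k ≤ d then homogeneousComponent (d - k) q * M else 0 := by
  conv_lhs => rw [← sum_homogeneousComponent q, Finset.sum_mul, map_sum]
  simp only [homogeneousComponent_of_mem ((homogeneousComponent_isHomogeneous _ q).mul hM)]
  split_ifs with h
  · by_cases hq : q.totalDegree < d - k
    · rw [homogeneousComponent_eq_zero _ _ hq, zero_mul]
      refine Finset.sum_eq_zero fun i hi => if_neg ?_
      have := Finset.mem_range.mp hi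
      omega
    · rw [Finset.sum_eq_single (d - k)]
      · rw [if_pos (by omega)]
      · intro b _ hb
        exact if_neg (by omega)
      · intro hb
        exact absurd (Finset.mem_range.mpr (by omega)) hb
  · exact Finset.sum_eq_zero fun i _ => if_neg (by omega)

lemma homogeneousComponent_minorComb {n k : ℕ} (q : IndexSet n k → IndexSet n k → Poly n) (d : ℕ) :
    homogeneousComponent d (minorComb q) =
      if k ≤ d then minorComb fun I J => homogeneousComponent (d - k) (q I J) else 0 := by
  simp only [minorComb, map_sum, homogeneousComponent_mul_of_isHomogeneous (minor_isHomogeneous _ _)]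
  split_ifs
  · rfl
  · simp

lemma homogeneousComponent_mem_minorIdeal {n k : ℕ} {P : Poly n} (hP : P ∈ minorIdeal n k)
    (d : ℕ) : homogeneousComponent d P ∈ minorIdeal n k := by
  obtain ⟨q, rfl⟩ := mem_minorIdeal_iff.mp hP
  rw [homogeneousComponent_minorComb]
  split_ifs
  · exact mem_minorIdeal_iff.mpr ⟨_, rfl⟩
  · exact Ideal.zero_mem _

/-- The minors have integer coefficients. This allows passing between orthogonality for the bilinear
and the Hermitian pairing. -/
lemma conjPoly_mem_minorIdeal {n k : ℕ} {P : Poly n} (hP : P ∈ minorIdeal n k) :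
    conjPoly P ∈ minorIdeal n k := by
  obtain ⟨q, rfl⟩ := mem_minorIdeal_iff.mp hP
  refine mem_minorIdeal_iff.mpr ⟨fun I J => conjPoly (q I J), ?_⟩
  simp only [minorComb, conjPoly, map_sum, map_mul]
  refine Finset.sum_congr rfl fun I _ => Finset.sum_congr rfl fun J _ => ?_
  congr 1
  rw [minor, RingHom.map_det]
  congr 1
  ext i j
  simp

lemma minorIdeal_le_idealOf (n r : ℕ) : minorIdeal n (r + 1) ≤ idealOf (rankVariety n r) := by
  refine Ideal.span_le.mpr ?_
  rintro _ ⟨⟨I, J⟩, rfl⟩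
  rw [SetLike.mem_coe, mem_idealOf]
  intro M hM
  have h : aeval (coords M) (minor I J) =
      (M.submatrix (I.1.orderEmbOfFin I.2) (J.1.orderEmbOfFin J.2)).det := by
    rw [minor, AlgHom.map_det]
    congr 1
    ext i j
    simp [coords]
  rw [h]
  by_contra hne
  have h1 := rank_of_det_ne_zero hne
  have h2 := rank_submatrix_le M (I.1.orderEmbOfFin I.2) (J.1.orderEmbOfFin J.2)
  rw [Fintype.card_fin] at h1
  have h3 : M.rank ≤ r := hM
  omega

/-! ### The ideal of the rank variety. -/

/-- The coefficients of the linear map `X ↦ Y * X * Z` on matrices. -/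
def sandwich {n k : ℕ} (Y : Matrix (Fin n) (Fin k) ℂ) (Z : Matrix (Fin k) (Fin n) ℂ) :
    Fin n × Fin n → Fin k × Fin k → ℂ := fun s t => Y s.1 t.1 * Z t.2 s.2

lemma aeval_linSubst_sandwich {n k : ℕ} (Y : Matrix (Fin n) (Fin k) ℂ)
    (Z : Matrix (Fin k) (Fin n) ℂ) (N : Mat k) (Q : Poly n) :
    aeval (coords N) (linSubst (sandwich Y Z) Q) = aeval (coords (Y * N * Z)) Q := by
  rw [linSubst, ← AlgHom.comp_apply, comp_aeval]
  congr 2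
  funext s
  simp only [coords, sandwich, map_sum, map_mul, aeval_X, aeval_C, Matrix.mul_apply,
    Fintype.sum_prod_type, Finset.sum_mul, Algebra.algebraMap_self, RingHom.id_apply]
  rw [Finset.sum_comm]
  refine Finset.sum_congr rfl fun _ _ => Finset.sum_congr rfl fun _ _ => ?_
  ring

/-- The transposed substitution sends det to det(YᵀXZᵀ), where X is the n × n matrix of variables.
-/
lemma linSubst_transpose_sandwich_det_mem {n k : ℕ} (Y : Matrix (Fin n) (Fin k) ℂ)
    (Z : Matrix (Fin k) (Fin n) ℂ) :
    linSubst (fun t s => sandwich Y Z s t) (mvPolynomialX (Fin k) (Fin k) ℂ).det ∈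
      minorIdeal n k := by
  have h : linSubst (fun t s => sandwich Y Z s t) (mvPolynomialX (Fin k) (Fin k) ℂ).det =
      ((Yᵀ.map C : Matrix _ _ (Poly n)) * mvPolynomialX (Fin n) (Fin n) ℂ * (Zᵀ.map C : Matrix _ _ (Poly n))).det := by
    rw [AlgHom.map_det]
    congr 1
    ext1 i j
    simp only [sandwich, AlgHom.mapMatrix_apply, Matrix.map_apply, mvPolynomialX_apply,
      linSubst_X, Fintype.sum_prod_type, Matrix.mul_apply, transpose_apply, Finset.sum_mul,
      map_mul]
    rw [Finset.sum_comm]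
    refine Finset.sum_congr rfl fun _ _ => Finset.sum_congr rfl fun _ _ => ?_
    ring
  rw [h]
  exact det_mul_mul_mem_minorIdeal _ _

lemma mem_idealOf_rankVariety_succ {n k : ℕ} {Q : Poly n} (hQ : Q ∈ idealOf (rankVariety n k))
    (horth : ∀ u ∈ minorIdeal n (k + 1), fischer u Q = 0) :
    Q ∈ idealOf (rankVariety n (k + 1)) := by
  rw [mem_idealOf] at hQ ⊢
  intro M hM
  obtain ⟨Y, Z, rfl⟩ := mem_rankVariety_iff.mp hM
  have hvan : ∀ N : Mat (k + 1), N.det = 0 →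
      aeval (coords N) (linSubst (sandwich Y Z) Q) = 0 := by
    intro N hN
    rw [aeval_linSubst_sandwich]
    refine hQ _ ?_
    have h1 : (Y * N * Z).rank ≤ N.rank :=
      (rank_mul_le_left _ _).trans (rank_mul_le_right _ _)
    have h2 : N.rank < k + 1 := by
      refine lt_of_le_of_ne (rank_le_width N) fun h => ?_
      have h3 : IsUnit N := by
        rw [← mulVec_surjective_iff_isUnit]
        have := LinearMap.range_eq_top.mp (Submodule.eq_top_of_finrank_eq
          (S := LinearMap.range N.mulVecLin) (by rw [← rank, h]; simp))
        exact this
      exact ((isUnit_iff_isUnit_det _).mp h3).ne_zero hN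
    exact h1.trans (Nat.lt_succ_iff.mp h2)
  obtain ⟨F, hF⟩ := det_dvd_of_vanishing _ hvan
  have hzero : linSubst (sandwich Y Z) Q = 0 := by
    -- Write one copy of the pullback as det * F and move the substitution to the other side: Q is
    -- then paired with an element of the minor ideal.
    apply eq_zero_of_fischer_conjPoly_self
    have hc : MvPolynomial.map (starRingEnd ℂ)
        (mvPolynomialX (Fin (k + 1)) (Fin (k + 1)) ℂ).det =
        (mvPolynomialX (Fin (k + 1)) (Fin (k + 1)) ℂ).det := by
      rw [RingHom.map_det]
      congr 1
      ext i j
      simp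
    have hconj : conjPoly (linSubst (sandwich Y Z) Q) =
        (mvPolynomialX (Fin (k + 1)) (Fin (k + 1)) ℂ).det * conjPoly F := by
      rw [hF, conjPoly, RingHom.map_mul, hc]
    rw [hconj]
    have := fischer_linSubst (fun t s => sandwich Y Z s t)
      ((mvPolynomialX (Fin (k + 1)) (Fin (k + 1)) ℂ).det * MvPolynomial.map (starRingEnd ℂ) F) Q
    refine this.symm.trans (horth _ ?_)
    rw [map_mul]
    exact Ideal.mul_mem_right _ _ (linSubst_transpose_sandwich_det_mem Y Z)
  have h1 := aeval_linSubst_sandwich Y Z 1 Q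
  rw [hzero, map_zero, Matrix.mul_one] at h1
  exact h1.symm

lemma eq_zero_of_mem_idealOf_of_orthogonal {n r : ℕ} {Q : Poly n}
    (hQ : Q ∈ idealOf (rankVariety n r))
    (horth : ∀ u ∈ minorIdeal n (r + 1), fischer u Q = 0) : Q = 0 := by
  have hanti : Antitone (minorIdeal n) := antitone_nat_of_succ_le (minorIdeal_succ_le n)
  have h : ∀ j, Q ∈ idealOf (rankVariety n (r + j)) := by
    intro j
    induction j with
    | zero => exact hQ
    | succ j ih =>
      exact mem_idealOf_rankVariety_succ ih fun u hu => horth u (hanti (by show r + 1 ≤ r + j + 1; omega) hu)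
  refine MvPolynomial.funext fun x => ?_
  have h1 := mem_idealOf.mp (h n) (Matrix.of fun i j => x (i, j))
    ((rank_le_width _).trans (by omega))
  rw [map_zero]
  exact h1

/-- The polynomials vanishing on the matrices of rank at most `r` form the ideal generated by the
minors of size `r + 1`. -/
theorem idealOf_rankVariety (n r : ℕ) : idealOf (rankVariety n r) = minorIdeal n (r + 1) := by
  refine le_antisymm (fun P hP => ?_) (minorIdeal_le_idealOf n r)
  -- The degree cutoff makes the space finite-dimensional.
  let W : Submodule ℂ (Poly n) := (minorIdeal n (r + 1)).restrictScalars ℂ ⊓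
    restrictTotalDegree (Fin n × Fin n) ℂ P.totalDegree
  have : FiniteDimensional ℂ W := Submodule.finiteDimensional_of_le inf_le_right
  obtain ⟨w, hw, horth⟩ := exists_sub_orthogonal fischerCore W P
  have hwI : w ∈ minorIdeal n (r + 1) := hw.1
  have hdeg : P - w ∈ restrictTotalDegree (Fin n × Fin n) ℂ P.totalDegree :=
    Submodule.sub_mem _ ((mem_restrictTotalDegree _ _ _).mpr le_rfl) hw.2
  have hzero : P - w = 0 := by
    refine eq_zero_of_mem_idealOf_of_orthogonal
      (Ideal.sub_mem _ hP (minorIdeal_le_idealOf n r hwI)) fun u hu => ?_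
    -- Only the part of u of degree at most that of P pairs with P - w. Conjugation is undone by the
    -- Hermitian pairing.
    let u' : Poly n := ∑ e ∈ Finset.range (P.totalDegree + 1), homogeneousComponent e (conjPoly u)
    have hu' : u' ∈ W := by
      refine ⟨Ideal.sum_mem _ fun e _ =>
        homogeneousComponent_mem_minorIdeal (conjPoly_mem_minorIdeal hu) e, ?_⟩
      refine Submodule.sum_mem _ fun e he => (mem_restrictTotalDegree _ _ _).mpr ?_
      exact ((homogeneousComponent_isHomogeneous e _).totalDegree_le).trans
        (Nat.lt_succ_iff.mp (Finset.mem_range.mp he))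
    have h1 : fischer (conjPoly u') (P - w) = 0 := horth u' hu'
    rw [← h1, fischer_comm, fischer_comm (conjPoly u'), fischer_eq_sum, fischer_eq_sum]
    refine Finset.sum_congr rfl fun m hm => ?_
    have hm' : m.degree ∈ Finset.range (P.totalDegree + 1) := by
      have h2 : m.degree ≤ P.totalDegree :=
        (le_totalDegree hm).trans ((mem_restrictTotalDegree _ _ _).mp hdeg)
      exact Finset.mem_range.mpr (by omega)
    congr 2
    rw [conjPoly, coeff_map, coeff_sum]
    simp only [coeff_homogeneousComponent]
    rw [Finset.sum_ite_eq, if_pos hm', conjPoly, coeff_map, Complex.conj_conj]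
  rw [sub_eq_zero] at hzero
  rwa [hzero]

/-! ### Zariski closure and irreducibility. -/

section Closure

variable {n : ℕ}

lemma mem_zariskiClosure {Z : Set (Mat n)} {M : Mat n} :
    M ∈ zariskiClosure Z ↔ ∀ P ∈ idealOf Z, aeval (coords M) P = 0 := Iff.rfl

lemma subset_zariskiClosure (Z : Set (Mat n)) : Z ⊆ zariskiClosure Z :=
  fun M hM _ hP => mem_idealOf.mp hP M hM

lemma idealOf_anti {Z Z' : Set (Mat n)} (h : Z ⊆ Z') : idealOf Z' ≤ idealOf Z :=
  fun _ hP => mem_idealOf.mpr fun M hM => mem_idealOf.mp hP M (h hM)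

lemma zariskiClosure_mono {Z Z' : Set (Mat n)} (h : Z ⊆ Z') :
    zariskiClosure Z ⊆ zariskiClosure Z' :=
  fun _ hM P hP => hM P (idealOf_anti h hP)

lemma idealOf_zariskiClosure (Z : Set (Mat n)) : idealOf (zariskiClosure Z) = idealOf Z :=
  le_antisymm (idealOf_anti (subset_zariskiClosure Z))
    fun P hP => mem_idealOf.mpr fun _ hM => hM P hP

lemma isZariskiClosed_zariskiClosure (Z : Set (Mat n)) : IsZariskiClosed (zariskiClosure Z) := by
  ext M
  rw [mem_zariskiClosure, idealOf_zariskiClosure, mem_zariskiClosure]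

lemma isZariskiClosed_of_subset {Z : Set (Mat n)} (h : zariskiClosure Z ⊆ Z) :
    IsZariskiClosed Z := Set.Subset.antisymm h (subset_zariskiClosure Z)

lemma IsZariskiClosed.inter {A B : Set (Mat n)} (hA : IsZariskiClosed A) (hB : IsZariskiClosed B) :
    IsZariskiClosed (A ∩ B) :=
  isZariskiClosed_of_subset fun _ hM =>
    ⟨hA.subset (zariskiClosure_mono Set.inter_subset_left hM),
      hB.subset (zariskiClosure_mono Set.inter_subset_right hM)⟩

lemma zariskiClosure_biUnion {ι : Type*} (T : Finset ι) (V : ι → Set (Mat n)) :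
    zariskiClosure (⋃ i ∈ T, V i) = ⋃ i ∈ T, zariskiClosure (V i) := by
  refine Set.Subset.antisymm (fun M hM => ?_) (Set.iUnion₂_subset fun i hi =>
    zariskiClosure_mono (Set.subset_biUnion_of_mem (u := V) hi))
  by_contra hnot
  have h : ∀ i, ∃ P : Poly n, i ∈ T → P ∈ idealOf (V i) ∧ aeval (coords M) P ≠ 0 := by
    intro i
    by_cases hi : i ∈ T
    · have : M ∉ zariskiClosure (V i) := fun h => hnot (Set.mem_biUnion hi h)
      rw [mem_zariskiClosure] at this
      push Not at this
      obtain ⟨P, hP⟩ := this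
      exact ⟨P, fun _ => hP⟩
    · exact ⟨0, fun h => absurd h hi⟩
  choose P hP using h
  -- The product of the separating polynomials vanishes on the union but not at M.
  have h1 : ∏ i ∈ T, P i ∈ idealOf (⋃ i ∈ T, V i) := by
    refine mem_idealOf.mpr fun N hN => ?_
    obtain ⟨i, hi, hNi⟩ := Set.mem_iUnion₂.mp hN
    rw [map_prod]
    exact Finset.prod_eq_zero hi (mem_idealOf.mp (hP i hi).1 N hNi)
  have h2 := hM _ h1
  rw [map_prod, Finset.prod_eq_zero_iff] at h2
  obtain ⟨i, hi, h0⟩ := h2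
  exact (hP i hi).2 h0

lemma IsIrreducibleVariety.exists_subset {ι : Type*} (T : Finset ι) (V : ι → Set (Mat n))
    (hV : ∀ i, IsZariskiClosed (V i)) {Z : Set (Mat n)} (hZ : IsIrreducibleVariety Z)
    (h : Z ⊆ ⋃ i ∈ T, V i) : ∃ i ∈ T, Z ⊆ V i := by
  classical
  induction T using Finset.induction_on with
  | empty =>
    obtain ⟨M, hM⟩ := hZ.2.1
    simpa using h hM
  | insert a T _ ih =>
    rw [Finset.set_biUnion_insert] at h
    have hclosed : IsZariskiClosed (⋃ i ∈ T, V i) := by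
      rw [IsZariskiClosed, zariskiClosure_biUnion]
      exact Set.iUnion₂_congr fun i _ => hV i
    have hsplit : Z = Z ∩ V a ∪ Z ∩ ⋃ i ∈ T, V i := by
      rw [← Set.inter_union_distrib_left, Set.inter_eq_left.mpr h]
    rcases hZ.2.2 _ _ (hZ.1.inter (hV a)) (hZ.1.inter hclosed) hsplit with h1 | h1
    · exact ⟨a, Finset.mem_insert_self a T, Set.inter_eq_left.mp h1.symm⟩
    · obtain ⟨i, hi, hZi⟩ := ih (Set.inter_eq_left.mp h1.symm)
      exact ⟨i, Finset.mem_insert_of_mem hi, hZi⟩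

lemma isIrreducibleVariety_of_isPrime {Z : Set (Mat n)} (hZ : IsZariskiClosed Z)
    (hne : Z.Nonempty) (hp : ∀ P Q : Poly n, P * Q ∈ idealOf Z → P ∈ idealOf Z ∨ Q ∈ idealOf Z) :
    IsIrreducibleVariety Z := by
  refine ⟨hZ, hne, fun A B hA hB hAB => ?_⟩
  have key : ∀ A : Set (Mat n), IsZariskiClosed A → A ⊆ Z → Z ≠ A →
      ∃ P ∈ idealOf A, P ∉ idealOf Z := by
    intro A hA hAZ hne
    by_contra hcon
    push Not at hcon
    refine hne (Set.Subset.antisymm (fun M hM => ?_) hAZ)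
    rw [← hA]
    exact fun P hP => mem_idealOf.mp (hcon P hP) M hM
  by_contra hcon
  push Not at hcon
  obtain ⟨P, hPA, hPZ⟩ := key A hA (hAB ▸ Set.subset_union_left) hcon.1
  obtain ⟨Q, hQB, hQZ⟩ := key B hB (hAB ▸ Set.subset_union_right) hcon.2
  have hPQ : P * Q ∈ idealOf Z := by
    refine mem_idealOf.mpr fun M hM => ?_
    rw [map_mul]
    rcases hAB.subset hM with h | h
    · rw [mem_idealOf.mp hPA M h, zero_mul]
    · rw [mem_idealOf.mp hQB M h, mul_zero]
  exact (hp P Q hPQ).elim hPZ hQZ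

end Closure

/-! ### The cones and the components of the rigidity variety. -/

section Cone

variable {n : ℕ}

/-- The sums of a matrix of rank at most `r` and a matrix supported on `S`. -/
def sumSet (r : ℕ) (S : Finset (Fin n × Fin n)) : Set (Mat n) :=
  {M | ∃ x ∈ rankVariety n r, ∃ y ∈ (coordSpace S : Set (Mat n)), M = x + y}

lemma rankCone_eq (r : ℕ) (S : Finset (Fin n × Fin n)) :
    rankCone r S = zariskiClosure (sumSet r S) := rfl

lemma mem_coordSpace_iff {S : Finset (Fin n × Fin n)} {B : Mat n} :
    B ∈ coordSpace S ↔ ∀ p ∉ S, B p.1 p.2 = 0 := by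
  constructor
  · intro hB p hp
    refine Submodule.span_induction (p := fun B _ => B p.1 p.2 = 0) ?_ ?_ ?_ ?_ hB
    · rintro _ ⟨q, hq, rfl⟩
      rw [single_apply, if_neg]
      rintro ⟨h1, h2⟩
      exact hp (Prod.ext h1 h2 ▸ hq)
    · rfl
    · intro x y _ _ hx hy
      rw [Matrix.add_apply, hx, hy, add_zero]
    · intro a x _ hx
      rw [Matrix.smul_apply, hx, smul_zero]
  · intro h
    have hB : B = ∑ p ∈ S, B p.1 p.2 • single p.1 p.2 (1 : ℂ) := by
      ext i j
      rw [Matrix.sum_apply]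
      by_cases hS : (i, j) ∈ S
      · rw [Finset.sum_eq_single (i, j)]
        · simp
        · intro q _ hq
          rw [Matrix.smul_apply, single_apply, if_neg, smul_zero]
          rintro ⟨h1, h2⟩
          exact hq (Prod.ext h1 h2)
        · exact fun h => absurd hS h
      · rw [h (i, j) hS, Finset.sum_eq_zero]
        intro q hq
        rw [Matrix.smul_apply, single_apply, if_neg, smul_zero]
        rintro ⟨h1, h2⟩
        exact hS (by subst h1 h2; exact hq)
    rw [hB]
    exact Submodule.sum_mem _ fun p hp => Submodule.smul_mem _ _ (Submodule.subset_span ⟨p, hp, rfl⟩)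

lemma rankVariety_subset_sumSet (r : ℕ) (S : Finset (Fin n × Fin n)) :
    rankVariety n r ⊆ sumSet r S :=
  fun M hM => ⟨M, hM, 0, Submodule.zero_mem _, (add_zero M).symm⟩

/-- The set is parametrized by (Y, Z, B) ↦ YZ + B, so its ideal is the kernel of θ, a map into a
domain. -/
lemma idealOf_sumSet_isPrime (r : ℕ) (S : Finset (Fin n × Fin n)) (P Q : Poly n)
    (h : P * Q ∈ idealOf (sumSet r S)) : P ∈ idealOf (sumSet r S) ∨ Q ∈ idealOf (sumSet r S) := by
  classical
  let θ : Poly n →ₐ[ℂ] MvPolynomial ((Fin n × Fin r) ⊕ (Fin r × Fin n) ⊕ (Fin n × Fin n)) ℂ :=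
    aeval fun p => (∑ l, X (.inl (p.1, l)) * X (.inr (.inl (l, p.2)))) +
      if p ∈ S then X (.inr (.inr p)) else 0
  have heval : ∀ (v : (Fin n × Fin r) ⊕ (Fin r × Fin n) ⊕ (Fin n × Fin n) → ℂ) (F : Poly n),
      aeval v (θ F) = aeval (coords ((of fun i l => v (.inl (i, l))) *
        (of fun l j => v (.inr (.inl (l, j)))) +
        (of fun i j => if (i, j) ∈ S then v (.inr (.inr (i, j))) else 0))) F := by
    intro v F
    rw [← AlgHom.comp_apply, comp_aeval]
    congr 2
    funext p
    rw [map_add, map_sum, apply_ite (aeval v)]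
    simp [coords, Matrix.mul_apply]
  have hmem : ∀ F : Poly n, F ∈ idealOf (sumSet r S) ↔ θ F = 0 := by
    intro F
    rw [mem_idealOf]
    constructor
    · intro hF
      refine MvPolynomial.funext fun v => ?_
      rw [map_zero]
      refine (heval v F).trans (hF _ ⟨_, mem_rankVariety_iff.mpr ⟨_, _, rfl⟩, _, ?_, rfl⟩)
      exact mem_coordSpace_iff.mpr fun p hp => if_neg hp
    · rintro hF _ ⟨x, hx, y, hy, rfl⟩
      obtain ⟨Y, Z, rfl⟩ := mem_rankVariety_iff.mp hx
      have h1 := heval (Sum.elim (fun p => Y p.1 p.2)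
        (Sum.elim (fun p => Z p.1 p.2) fun p => y p.1 p.2)) F
      rw [hF, map_zero] at h1
      rw [h1]
      congr 3
      congr 1
      ext i j
      simp only [of_apply, Sum.elim_inr]
      split_ifs with hij
      · rfl
      · exact mem_coordSpace_iff.mp hy (i, j) hij
  simp only [hmem] at h ⊢
  rw [map_mul] at h
  exact mul_eq_zero.mp h

lemma isIrreducibleVariety_rankCone (r : ℕ) (S : Finset (Fin n × Fin n)) :
    IsIrreducibleVariety (rankCone r S) := by
  refine isIrreducibleVariety_of_isPrime (isZariskiClosed_zariskiClosure _)
    ⟨0, subset_zariskiClosure _ (rankVariety_subset_sumSet r S ?_)⟩ ?_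
  · simp [rankVariety]
  · rw [rankCone_eq, idealOf_zariskiClosure]
    exact idealOf_sumSet_isPrime r S

lemma rigidSet_eq_biUnion (r s : ℕ) (hs : s ≤ n ^ 2) :
    rigidSet n r s = ⋃ S ∈ (Finset.univ : Finset (Fin n × Fin n)).powersetCard s, sumSet r S := by
  classical
  ext M
  simp only [Set.mem_iUnion, Finset.mem_powersetCard, exists_prop]
  constructor
  · intro hM
    have hne : {t | ∃ A ∈ rankVariety n r, ∃ B : Mat n, numNonzero B = t ∧ M = A + B}.Nonempty :=
      ⟨_, 0, by simp [rankVariety], M, rfl, (zero_add M).symm⟩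
    obtain ⟨A, hA, B, hB, hMAB⟩ := Nat.sInf_mem hne
    have hle : numNonzero B ≤ s := hB.trans_le hM
    have hcard : (Finset.univ.filter fun p : Fin n × Fin n => B p.1 p.2 ≠ 0).card ≤ s := by
      rw [numNonzero, Set.ncard_eq_toFinset_card'] at hle
      simpa using hle
    -- The support may have fewer than s elements; s ≤ n² leaves room to enlarge it to exactly s.
    obtain ⟨S, hS, hSs⟩ := Finset.exists_superset_card_eq hcard (by simpa [sq] using hs)
    refine ⟨S, ⟨Finset.subset_univ S, hSs⟩, A, hA, B, ?_, hMAB⟩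
    refine mem_coordSpace_iff.mpr fun p hp => ?_
    by_contra hne
    exact hp (hS (by simpa using hne))
  · rintro ⟨S, ⟨_, hS⟩, A, hA, B, hB, rfl⟩
    refine (Nat.sInf_le ⟨A, hA, B, rfl, rfl⟩ : rigidity r (A + B) ≤ numNonzero B).trans ?_
    rw [← hS, numNonzero, ← Set.ncard_coe_finset]
    refine Set.ncard_le_ncard (fun p hp => ?_) S.finite_toSet
    by_contra hpS
    exact hp (mem_coordSpace_iff.mp hB p hpS)

lemma rigidVariety_eq_biUnion (r s : ℕ) (hs : s ≤ n ^ 2) :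
    rigidVariety n r s =
      ⋃ S ∈ (Finset.univ : Finset (Fin n × Fin n)).powersetCard s, rankCone r S := by
  rw [rigidVariety, rigidSet_eq_biUnion r s hs, zariskiClosure_biUnion]
  rfl

lemma exists_eq_rankCone_of_isComponentOf {r s : ℕ} (hs : s ≤ n ^ 2) {Z : Set (Mat n)}
    (hZ : IsComponentOf Z (rigidVariety n r s)) :
    ∃ S : Finset (Fin n × Fin n), S.card = s ∧ Z = rankCone r S := by
  have hsub := hZ.prop.2
  rw [rigidVariety_eq_biUnion r s hs] at hsub
  obtain ⟨S, hS, hZS⟩ := hZ.prop.1.exists_subset _ (fun S => rankCone r S)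
    (fun S => isZariskiClosed_zariskiClosure _) hsub
  refine ⟨S, (Finset.mem_powersetCard.mp hS).2, Set.Subset.antisymm hZS ?_⟩
  -- The cone is itself irreducible and contained in the variety, so maximality of Z forces
  -- equality.
  refine hZ.le_of_ge ⟨isIrreducibleVariety_rankCone r S, ?_⟩ hZS
  rw [rigidVariety_eq_biUnion r s hs]
  exact Set.subset_biUnion_of_mem (u := fun S => rankCone r S) hS

end Cone

/-! ### The ideal of the cone. -/

section Ideal

variable {n : ℕ} {S : Finset (Fin n × Fin n)}

lemma aeval_add_of_avoidsVars {P : Poly n} (hP : AvoidsVars S P) (A : Mat n) {B : Mat n}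
    (hB : B ∈ coordSpace S) : aeval (coords (A + B)) P = aeval (coords A) P := by
  refine hom_congr_vars (f₁ := (aeval (coords (A + B)) : Poly n →ₐ[ℂ] ℂ).toRingHom)
    (f₂ := (aeval (coords A) : Poly n →ₐ[ℂ] ℂ).toRingHom) ?_ ?_ rfl
  · ext a
    simp
  · intro p hp _
    have := mem_coordSpace_iff.mp hB p (hP p hp)
    simp [coords, this]

lemma mem_idealOf_rankCone_of_avoidsVars {r : ℕ} {P : Poly n} (hP : AvoidsVars S P)
    (h : P ∈ minorIdeal n (r + 1)) : P ∈ idealOf (rankCone r S) := by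
  rw [rankCone_eq, idealOf_zariskiClosure, mem_idealOf]
  rintro _ ⟨A, hA, B, hB, rfl⟩
  rw [aeval_add_of_avoidsVars hP A hB]
  exact mem_idealOf.mp (minorIdeal_le_idealOf n r h) A hA

lemma avoidsVars_iff_mem_supported {P : Poly n} :
    AvoidsVars S P ↔ P ∈ supported ℂ ((S : Set (Fin n × Fin n))ᶜ) := by
  rw [mem_supported]
  rfl

open Classical in
/-- The coefficient of the monomial `α` in the variables of `S` in `P`, as a polynomial in the
other variables. -/
def coeffIn (S : Finset (Fin n × Fin n)) (P : Poly n) (α : Fin n × Fin n →₀ ℕ) : Poly n :=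
  ∑ m ∈ P.support with m.filter (· ∈ S) = α, monomial (m.filter fun p => ¬ p ∈ S) (P.coeff m)

open Classical in
lemma sum_monomial_mul_coeffIn (S : Finset (Fin n × Fin n)) (P : Poly n) :
    ∑ α ∈ P.support.image (fun m => m.filter (· ∈ S)), monomial α 1 * coeffIn S P α = P := by
  have h := Finset.sum_fiberwise_of_maps_to
    (s := P.support) (fun m hm => Finset.mem_image_of_mem
      (fun m : Fin n × Fin n →₀ ℕ => m.filter (· ∈ S)) hm)
    (fun m => monomial m (P.coeff m))
  refine Eq.trans ?_ (h.trans P.as_sum.symm)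
  refine Finset.sum_congr rfl fun α _ => ?_
  rw [coeffIn, Finset.mul_sum]
  refine Finset.sum_congr rfl fun m hm => ?_
  rw [monomial_mul, one_mul, ← (Finset.mem_filter.mp hm).2, Finsupp.filter_add_filter_not]

lemma monomial_mem_supported {σ R : Type*} [CommSemiring R] {s : Set σ} {m : σ →₀ ℕ} (a : R)
    (h : ∀ p ∈ m.support, p ∈ s) : monomial m a ∈ supported R s := by
  classical
  rw [mem_supported]
  intro p hp
  by_cases ha : a = 0
  · simp [ha] at hp
  · rw [vars_monomial ha] at hp
    exact h p hp

lemma avoidsVars_coeffIn (P : Poly n) (α : Fin n × Fin n →₀ ℕ) : AvoidsVars S (coeffIn S P α) := by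
  classical
  rw [avoidsVars_iff_mem_supported, coeffIn]
  refine Subalgebra.sum_mem _ fun m _ => monomial_mem_supported _ fun p hp => ?_
  have := (Finsupp.mem_support_iff.mp hp)
  rw [Finsupp.filter_apply] at this
  by_contra hpS
  exact this (if_neg (by simpa using hpS))

lemma coeffIn_mem_idealOf {r : ℕ} {P : Poly n} (hP : P ∈ idealOf (rankCone r S))
    (α : Fin n × Fin n →₀ ℕ) : coeffIn S P α ∈ idealOf (rankVariety n r) := by
  classical
  rw [rankCone_eq, idealOf_zariskiClosure, mem_idealOf] at hP
  rw [mem_idealOf]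
  intro M hM
  -- Φ fixes the variables of S and evaluates the others at M, so the coefficients of Φ P are the
  -- values at M of the `coeffIn S P β`.
  let Φ : Poly n →ₐ[ℂ] Poly n := aeval fun p => if p ∈ S then X p else C (coords M p)
  have hzero : Φ P = 0 := by
    refine MvPolynomial.funext fun y => ?_
    rw [map_zero]
    -- Adding y - M on S gives the entries on S the arbitrary values y.
    have h1 := hP _ ⟨M, hM, of fun i j => if (i, j) ∈ S then y (i, j) - M i j else 0,
      mem_coordSpace_iff.mpr fun p hp => if_neg hp, rfl⟩
    rw [← h1]
    change aeval y (Φ P) = _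
    rw [← AlgHom.comp_apply, comp_aeval]
    congr 2
    funext p
    by_cases hp : p ∈ S
    · simp [hp, coords]
    · simp [hp, coords]
  have hcoeff : ∀ β, Φ (coeffIn S P β) = C (aeval (coords M) (coeffIn S P β)) := by
    intro β
    refine hom_congr_vars (f₁ := Φ.toRingHom)
      (f₂ := (C : ℂ →+* Poly n).comp (aeval (coords M) : Poly n →ₐ[ℂ] ℂ).toRingHom) ?_ ?_ rfl
    · ext a : 1
      simp [Φ]
    · intro p hp _
      simp [Φ, avoidsVars_coeffIn P β p hp]
  have hmon : ∀ β ∈ P.support.image (fun m => m.filter (· ∈ S)),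
      Φ (monomial β 1) = monomial β 1 := by
    intro β hβ
    obtain ⟨m, _, rfl⟩ := Finset.mem_image.mp hβ
    have h1 := monomial_mem_supported (1 : ℂ) (s := (S : Set (Fin n × Fin n)))
      (m := m.filter (· ∈ S)) fun p hp => by
        have := (Finsupp.mem_support_iff.mp hp)
        rw [Finsupp.filter_apply] at this
        by_contra hpS
        exact this (if_neg hpS)
    refine hom_congr_vars (f₁ := Φ.toRingHom) (f₂ := RingHom.id (Poly n)) ?_ ?_ rfl
    · ext a : 1
      simp [Φ]
    · intro p hp _
      have hpS : p ∈ S := mem_supported.mp h1 hp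
      simp [Φ, hpS]
  rw [← sum_monomial_mul_coeffIn S P, map_sum] at hzero
  by_cases hα : α ∈ P.support.image (fun m => m.filter (· ∈ S))
  · have h2 := congrArg (coeff α) hzero
    rw [coeff_sum, Finset.sum_eq_single α] at h2
    · rw [map_mul, hmon α hα, hcoeff, mul_comm, C_mul_monomial, mul_one, coeff_monomial,
        if_pos rfl, coeff_zero] at h2
      exact h2
    · intro β hβ hne
      rw [map_mul, hmon β hβ, hcoeff, mul_comm, C_mul_monomial, mul_one, coeff_monomial,
        if_neg hne]
    · exact fun h => absurd hα h
  · have : coeffIn S P α = 0 := by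
      rw [coeffIn, Finset.filter_false_of_mem, Finset.sum_empty]
      intro m hm h
      exact hα (Finset.mem_image.mpr ⟨m, hm, h⟩)
    rw [this, map_zero]

lemma AvoidsVars.homogeneousComponent {P : Poly n} (hP : AvoidsVars S P) (d : ℕ) :
    AvoidsVars S (homogeneousComponent d P) := by
  intro p hp
  rw [mem_vars_iff_mem_support] at hp
  obtain ⟨m, hm, hpm⟩ := hp
  rw [support_homogeneousComponent, Finset.mem_filter] at hm
  exact hP p ((mem_vars_iff_mem_support _).mpr ⟨m, hm.1, hpm⟩)

/-- Taking homogeneous components keeps S avoided, and since all the minors have degree r+1 it gives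
the q one common degree. -/
theorem idealOf_rankCone (r : ℕ) (S : Finset (Fin n × Fin n)) :
    idealOf (rankCone r S) = Ideal.span {P : Poly n | AvoidsVars S P ∧
      ∃ (e : ℕ) (q : IndexSet n (r + 1) → IndexSet n (r + 1) → Poly n),
        (∀ I J, (q I J).IsHomogeneous e) ∧ P = minorComb q} := by
  classical
  apply le_antisymm
  · intro P hP
    rw [← sum_monomial_mul_coeffIn S P]
    refine Ideal.sum_mem _ fun α _ => Ideal.mul_mem_left _ _ ?_
    have hmem := coeffIn_mem_idealOf hP α
    have havoid := avoidsVars_coeffIn (S := S) P α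
    rw [idealOf_rankVariety, mem_minorIdeal_iff] at hmem
    obtain ⟨q, hq⟩ := hmem
    rw [← sum_homogeneousComponent (coeffIn S P α)]
    refine Ideal.sum_mem _ fun d _ => ?_
    have hd := havoid.homogeneousComponent d
    rw [hq, homogeneousComponent_minorComb] at hd ⊢
    split_ifs at hd ⊢ with h
    · exact Ideal.subset_span
        ⟨hd, d - (r + 1), _, fun I J => homogeneousComponent_isHomogeneous _ _, rfl⟩
    · exact Ideal.zero_mem _
  · refine Ideal.span_le.mpr ?_
    rintro P ⟨hP, e, q, _, rfl⟩
    exact mem_idealOf_rankCone_of_avoidsVars hP (mem_minorIdeal_iff.mpr ⟨q, rfl⟩)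

lemma eq_zero_of_mem_minorIdeal {k : ℕ} {P : Poly n} (hP : P ∈ minorIdeal n k)
    (hdeg : P.totalDegree < k) : P = 0 := by
  obtain ⟨q, rfl⟩ := mem_minorIdeal_iff.mp hP
  rw [← sum_homogeneousComponent (minorComb q)]
  refine Finset.sum_eq_zero fun d hd => ?_
  rw [homogeneousComponent_minorComb, if_neg]
  have := Finset.mem_range.mp hd
  omega

/-- The cone contains the rank variety, so it inherits the bound that excludes equations of degree
at most r. -/
lemma idealOf_rankCone_le (r : ℕ) (S : Finset (Fin n × Fin n)) :
    idealOf (rankCone r S) ≤ minorIdeal n (r + 1) := by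
  rw [rankCone_eq, idealOf_zariskiClosure, ← idealOf_rankVariety]
  exact idealOf_anti (rankVariety_subset_sumSet r S)

end Ideal

end MatrixRigidity

end

theorem mainTheorem3 (n r : ℕ) :
    (∀ s : ℕ, s ≤ n ^ 2 → ∀ Z : Set (MatrixRigidity.Mat n),
      MatrixRigidity.IsComponentOf Z (MatrixRigidity.rigidVariety n r s) →
        ∃ S : Finset (Fin n × Fin n), S.card = s ∧ Z = MatrixRigidity.rankCone r S) ∧
    (∀ S : Finset (Fin n × Fin n),
      -- generators of the ideal
      MatrixRigidity.idealOf (MatrixRigidity.rankCone r S) =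
        Ideal.span {P : MatrixRigidity.Poly n |
          MatrixRigidity.AvoidsVars S P ∧
          ∃ (e : ℕ) (q : MatrixRigidity.IndexSet n (r + 1) → MatrixRigidity.IndexSet n (r + 1) →
              MatrixRigidity.Poly n),
            (∀ I J, (q I J).IsHomogeneous e) ∧ P = MatrixRigidity.minorComb q} ∧
      -- no equations of degree at most r
      (∀ P ∈ MatrixRigidity.idealOf (MatrixRigidity.rankCone r S), P.totalDegree ≤ r → P = 0) ∧
      -- converse
      (∀ q : MatrixRigidity.IndexSet n (r + 1) → MatrixRigidity.IndexSet n (r + 1) →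
          MatrixRigidity.Poly n,
        MatrixRigidity.AvoidsVars S (MatrixRigidity.minorComb q) →
          MatrixRigidity.minorComb q ∈
            MatrixRigidity.idealOf (MatrixRigidity.rankCone r S))) := by
  refine ⟨fun s hs Z hZ => MatrixRigidity.exists_eq_rankCone_of_isComponentOf hs hZ, fun S =>
    ⟨MatrixRigidity.idealOf_rankCone r S, fun P hP hdeg => ?_, fun q hq => ?_⟩⟩
  · exact MatrixRigidity.eq_zero_of_mem_minorIdeal (MatrixRigidity.idealOf_rankCone_le r S hP)
      (Nat.lt_succ_of_le hdeg)
  · exact MatrixRigidity.mem_idealOf_rankCone_of_avoidsVars hq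
      (MatrixRigidity.mem_minorIdeal_iff.mpr ⟨q, rfl⟩)
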